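/- Let $n\ge 0$. The shifted staircase $\delta_n=(n,n-1,\ldots,1)$ is the array of boxes with rows $1,\ldots,n$ in which row $i$ has $n+1-i$ boxes and starts one box to the right of row $i-1$; the shape $\delta_n\setminus\delta_1$ (for $n\ge1$) is obtained from it by removing the last box of its first row. A (shifted) standard tableau of such a shape with $N$ boxes is a filling of the boxes with $1,\ldots,N$, each used exactly once, that increases along rows from left to right and down columns. Put $$g_n=\frac{\binom{n+1}{2}!}{\prod_{0\le i<j\le n}(i+j)},\qquad C_m=\frac{1}{m+1}\binom{2m}{m}.$$ Then $g_n$ is the number of standard tableaux of the shifted staircase $\delta_n$, and for $n\ge 3$ the number of shifted standard tableaux of shape $\delta_n\setminus\delta_1$ is $$g_n\,\frac{C_nC_{n-2}}{2\,C_{2n-3}}.$$ -/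

import Mathlib

open scoped Nat

/-- The staircase partition `δ_k = (k, k - 1, …, 1)`, written as a sequence of parts indexed
from `0` and followed by zeros. -/
def staircase (k : ℕ) : ℕ → ℕ := fun i => k - i

/-- The shifted diagram of truncated shape `lam ∖ mu` (for `mu i ≤ lam i`): the boxes are pairs
(row, column), counted from `0`. Row `i` starts in column `i`, that is, one box to the right of
row `i - 1`, and has `lam i - mu i` boxes. -/
def shiftedTruncatedDiagram (lam mu : ℕ → ℕ) : Set (ℕ × ℕ) :=
  {c | c.1 ≤ c.2 ∧ c.2 < c.1 + (lam c.1 - mu c.1)}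

/-- A standard tableau of shape `D`: a filling of the boxes of `D` with the integers from `1` to
the number of boxes, each used exactly once, increasing across rows and down columns. -/
structure IsStandardTableau (D : Set (ℕ × ℕ)) (T : D → ℕ) : Prop where
  bijOn : Set.BijOn T Set.univ (Set.Icc 1 D.ncard)
  row_lt : ∀ a b : D, a.1.1 = b.1.1 → a.1.2 < b.1.2 → T a < T b
  col_lt : ∀ a b : D, a.1.2 = b.1.2 → a.1.1 < b.1.1 → T a < T b

/-- The number of standard tableaux of shape `D`. -/
noncomputable def numStandardTableaux (D : Set (ℕ × ℕ)) : ℕ :=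
  Nat.card {T : D → ℕ // IsStandardTableau D T}

/-- `g_n = binom(n+1, 2)! / ∏_{0 ≤ i < j ≤ n} (i + j)`. -/
def staircaseNumber (n : ℕ) : ℚ :=
  ((Nat.choose (n + 1) 2)! : ℚ) /
    ∏ j ∈ Finset.range (n + 1), ∏ i ∈ Finset.range j, ((i : ℚ) + (j : ℚ))

/-! The largest entry of a standard tableau sits in a corner, so tableau counts satisfy a recursion
over corners. Shifted shapes are encoded by their finite sets of parts; there the recursion reads
`shiftedCount = downSum shiftedCount`, where `downSum` lowers one part by one. The product formula
`shiftedCount_eq_factorial_mul` solves it, by an identity from Lagrange interpolation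
(`sum_mul_prod_one_sub_div`). At the parts `1, …, n` it gives the untruncated count.

For the truncated shape with rows `m, m, μ`, the recursion acquires an inhomogeneous term, an
ordinary shifted count (`truncatedCount_eq`). A solution is built from neutral fermions `φ_b`, which
satisfy `φ_b D = φ_{b-1} + D φ_b` for `D = downSum` (`fermion_downSum`). If `f_a` counts shapes with
an extra largest part `a`, then `f_{a+1} = f_a + D f_{a+1}`. Hence in the alternating sum of
`φ_{m-1-k} f_{m+1+k}` everything except the `D` terms telescopes to `φ_{m-1} f_m`, which is exactly
the inhomogeneous term. Both sides therefore agree, by induction on the size of `μ`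
(`truncatedCount_eq_alternatingCount`).

For `m = p + 1` and `μ = {1, …, p}` no creation term survives. The product formula turns the
remaining ones into an alternating binomial sum of Beta type
(`sum_alternating_choose_mul_factorial_div`), and factorials rearrange into Catalan numbers. -/

/-! ### Standard tableaux and removal of the largest entry -/

/-- The standard tableaux of shape `D`, extended by `0` to all of `ℕ × ℕ`. -/
def extendedTableaux (D : Set (ℕ × ℕ)) : Set (ℕ × ℕ → ℕ) :=
  {T | Set.BijOn T D (Set.Icc 1 D.ncard) ∧ (∀ x ∉ D, T x = 0) ∧
    (∀ a ∈ D, ∀ b ∈ D, a.1 = b.1 → a.2 < b.2 → T a < T b) ∧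
    (∀ a ∈ D, ∀ b ∈ D, a.2 = b.2 → a.1 < b.1 → T a < T b)}

/-- A cell of `D` with no cell of `D` to its right or below it. -/
def IsCornerCell (D : Set (ℕ × ℕ)) (c : ℕ × ℕ) : Prop :=
  c ∈ D ∧ ∀ x ∈ D, (x.1 = c.1 → x.2 ≤ c.2) ∧ (x.2 = c.2 → x.1 ≤ c.1)

theorem numStandardTableaux_eq_card (D : Set (ℕ × ℕ)) :
    numStandardTableaux D = Nat.card (extendedTableaux D) := by
  classical
  refine Nat.card_congr
    { toFun := fun T => ⟨fun x => if h : x ∈ D then T.1 ⟨x, h⟩ else 0, ?_, ?_, ?_, ?_⟩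
      invFun := fun T => ⟨fun x => T.1 x.1, ?_, ?_, ?_⟩
      left_inv := ?_
      right_inv := ?_ }
  · obtain ⟨T, hT⟩ := T
    refine ⟨fun x hx => ?_, fun x hx y hy hxy => ?_, fun k hk => ?_⟩
    · simp only [hx, dite_true]
      exact hT.bijOn.mapsTo (Set.mem_univ _)
    · simp only [hx, hy, dite_true] at hxy
      simpa using hT.bijOn.injOn (Set.mem_univ _) (Set.mem_univ _) hxy
    · obtain ⟨x, -, hx⟩ := hT.bijOn.surjOn hk
      exact ⟨x.1, x.2, by simpa using hx⟩
  · intro x hx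
    simp [hx]
  · intro a ha b hb h1 h2
    simp only [ha, hb, dite_true]
    exact T.2.row_lt ⟨a, ha⟩ ⟨b, hb⟩ h1 h2
  · intro a ha b hb h1 h2
    simp only [ha, hb, dite_true]
    exact T.2.col_lt ⟨a, ha⟩ ⟨b, hb⟩ h1 h2
  · refine ⟨fun x _ => T.2.1.mapsTo x.2, fun x _ y _ hxy => ?_, fun k hk => ?_⟩
    · exact Subtype.ext (T.2.1.injOn x.2 y.2 hxy)
    · obtain ⟨x, hx, h⟩ := T.2.1.surjOn hk
      exact ⟨⟨x, hx⟩, Set.mem_univ _, h⟩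
  · exact fun a b => T.2.2.2.1 a.1 a.2 b.1 b.2
  · exact fun a b => T.2.2.2.2 a.1 a.2 b.1 b.2
  · intro T
    ext x
    simp
  · intro T
    ext x
    by_cases h : x ∈ D
    · simp [h]
    · simp [h, T.2.2.1 x h]

theorem finite_extendedTableaux {D : Set (ℕ × ℕ)} (hD : D.Finite) :
    Finite (extendedTableaux D) := by
  have := hD.to_subtype
  let f : extendedTableaux D → (D → Fin (D.ncard + 1)) := fun T x =>
    ⟨T.1 x.1, Nat.lt_succ_of_le (T.2.1.mapsTo x.2).2⟩
  refine Finite.of_injective f fun T T' h => ?_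
  ext x
  by_cases hx : x ∈ D
  · simpa [f] using congrFun h ⟨x, hx⟩
  · rw [T.2.2.1 x hx, T'.2.2.1 x hx]

theorem extendedTableaux_le {D : Set (ℕ × ℕ)} {T : ℕ × ℕ → ℕ} (hT : T ∈ extendedTableaux D)
    (x : ℕ × ℕ) : T x ≤ D.ncard := by
  by_cases hx : x ∈ D
  · exact (hT.1.mapsTo hx).2
  · simp [hT.2.1 x hx]

theorem update_mem_extendedTableaux {D : Set (ℕ × ℕ)} (hD : D.Finite) {c : ℕ × ℕ}
    (hc : IsCornerCell D c) {T : ℕ × ℕ → ℕ} (hT : T ∈ extendedTableaux (D \ {c})) :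
    Function.update T c D.ncard ∈ extendedTableaux D := by
  have hN : (D \ {c}).ncard + 1 = D.ncard := Set.ncard_sdiff_singleton_add_one hc.1 hD
  obtain ⟨h1, h2, h3, h4⟩ := hT
  have hlt : ∀ x, T x < D.ncard := fun x => by
    have := extendedTableaux_le ⟨h1, h2, h3, h4⟩ x
    omega
  refine ⟨⟨fun x hx => ?_, fun x hx y hy hxy => ?_, fun k hk => ?_⟩, fun x hx => ?_,
    fun a ha b hb e l => ?_, fun a ha b hb e l => ?_⟩
  · by_cases h : x = c
    · subst h
      simp only [Function.update_self, Set.mem_Icc]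
      omega
    · have := h1.mapsTo (⟨hx, h⟩ : x ∈ D \ {c})
      simp only [Function.update_of_ne h, Set.mem_Icc] at this ⊢
      omega
  · by_cases h : x = c <;> by_cases h' : y = c
    · rw [h, h']
    · subst h
      rw [Function.update_self, Function.update_of_ne h'] at hxy
      exact absurd hxy (hlt y).ne'
    · subst h'
      rw [Function.update_self, Function.update_of_ne h] at hxy
      exact absurd hxy (hlt x).ne
    · rw [Function.update_of_ne h, Function.update_of_ne h'] at hxy
      exact h1.injOn ⟨hx, h⟩ ⟨hy, h'⟩ hxy
  · by_cases h : k = D.ncard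
    · exact ⟨c, hc.1, by simp [h]⟩
    · obtain ⟨x, hx, rfl⟩ := h1.surjOn (⟨hk.1, by have := hk.2; omega⟩ :
        k ∈ Set.Icc 1 (D \ {c}).ncard)
      exact ⟨x, hx.1, Function.update_of_ne hx.2 _ _⟩
  · rw [Function.update_of_ne (by rintro rfl; exact hx hc.1)]
    exact h2 x fun h => hx h.1
  · have hac : a ≠ c := by
      rintro rfl
      have := (hc.2 b hb).1 e.symm
      omega
    rw [Function.update_of_ne hac]
    by_cases h : b = c
    · subst h
      rw [Function.update_self]
      exact hlt a
    · rw [Function.update_of_ne h]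
      exact h3 a ⟨ha, hac⟩ b ⟨hb, h⟩ e l
  · have hac : a ≠ c := by
      rintro rfl
      have := (hc.2 b hb).2 e.symm
      omega
    rw [Function.update_of_ne hac]
    by_cases h : b = c
    · subst h
      rw [Function.update_self]
      exact hlt a
    · rw [Function.update_of_ne h]
      exact h4 a ⟨ha, hac⟩ b ⟨hb, h⟩ e l

theorem update_zero_mem_extendedTableaux {D : Set (ℕ × ℕ)} (hD : D.Finite) {c : ℕ × ℕ}
    (hc : c ∈ D) {T : ℕ × ℕ → ℕ} (hT : T ∈ extendedTableaux D) (hTc : T c = D.ncard) :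
    IsCornerCell D c ∧ Function.update T c 0 ∈ extendedTableaux (D \ {c}) := by
  have hN : (D \ {c}).ncard + 1 = D.ncard := Set.ncard_sdiff_singleton_add_one hc hD
  obtain ⟨h1, h2, h3, h4⟩ := hT
  have hle : ∀ x, T x ≤ D.ncard := extendedTableaux_le ⟨h1, h2, h3, h4⟩
  have hu : ∀ x ∈ D \ {c}, Function.update T c 0 x = T x := fun x hx =>
    Function.update_of_ne hx.2 _ _
  refine ⟨⟨hc, fun x hx => ⟨fun e => ?_, fun e => ?_⟩⟩,
    ⟨fun x hx => ?_, fun x hx y hy hxy => ?_, fun k hk => ?_⟩, fun x hx => ?_,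
    fun a ha b hb e l => ?_, fun a ha b hb e l => ?_⟩
  · by_contra! l
    have := h3 c hc x hx e.symm l
    have := hle x
    omega
  · by_contra! l
    have := h4 c hc x hx e.symm l
    have := hle x
    omega
  · rw [hu x hx]
    have h5 := h1.mapsTo hx.1
    have : T x ≠ D.ncard := fun h => hx.2 (h1.injOn hx.1 hc (h.trans hTc.symm))
    simp only [Set.mem_Icc] at h5 ⊢
    omega
  · rw [hu x hx, hu y hy] at hxy
    exact h1.injOn hx.1 hy.1 hxy
  · simp only [Set.mem_Icc] at hk
    obtain ⟨x, hx, rfl⟩ := h1.surjOn (by simp only [Set.mem_Icc]; omega : k ∈ Set.Icc 1 D.ncard)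
    have : x ∈ D \ {c} := ⟨hx, by rintro rfl; omega⟩
    exact ⟨x, this, hu x this⟩
  · by_cases h : x = c
    · simp [h]
    · rw [Function.update_of_ne h]
      exact h2 x fun h' => hx ⟨h', h⟩
  · rw [hu a ha, hu b hb]
    exact h3 a ha.1 b hb.1 e l
  · rw [hu a ha, hu b hb]
    exact h4 a ha.1 b hb.1 e l

/-- Removing the largest entry of a standard tableau. -/
theorem numStandardTableaux_eq_sum_corners {D : Set (ℕ × ℕ)} (hD : D.Finite) (hne : D.Nonempty)
    (M : Finset (ℕ × ℕ)) (hM : ∀ c, c ∈ M ↔ IsCornerCell D c) :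
    numStandardTableaux D = ∑ c ∈ M, numStandardTableaux (D \ {c}) := by
  have hfin : ∀ c : M, Finite (extendedTableaux (D \ {c.1})) := fun c =>
    finite_extendedTableaux (hD.subset Set.sdiff_subset)
  have hpos : 0 < D.ncard := (Set.ncard_pos hD).2 hne
  simp only [numStandardTableaux_eq_card]
  rw [← Finset.sum_coe_sort M fun c => Nat.card (extendedTableaux (D \ {c})), ← Nat.card_sigma]
  symm
  refine Nat.card_congr (Equiv.ofBijective
    (fun p : Σ c : M, extendedTableaux (D \ {c.1}) =>
      (⟨Function.update p.2.1 p.1.1 D.ncard,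
        update_mem_extendedTableaux hD ((hM _).1 p.1.2) p.2.2⟩ : extendedTableaux D)) ⟨?_, ?_⟩)
  · rintro ⟨⟨c, hc⟩, T, hT⟩ ⟨⟨c', hc'⟩, T', hT'⟩ h
    simp only [Subtype.mk.injEq] at h
    have hN : (D \ {c'}).ncard + 1 = D.ncard :=
      Set.ncard_sdiff_singleton_add_one ((hM _).1 hc').1 hD
    change T' ∈ extendedTableaux (D \ {c'}) at hT'
    -- The first filling has `D.ncard` at `c`, while away from `c'` the second has entries at most
    -- `D.ncard - 1`.
    have hcc : c = c' := by
      by_contra hne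
      have h1 := congrFun h c
      rw [Function.update_self, Function.update_of_ne hne] at h1
      have := extendedTableaux_le hT' c
      omega
    subst hcc
    have : T = T' := by
      ext x
      by_cases hx : x = c
      · rw [hx, hT.2.1 c (by simp), hT'.2.1 c (by simp)]
      · simpa [hx] using congrFun h x
    subst this
    rfl
  · rintro ⟨T, hT⟩
    obtain ⟨c, hc, hTc⟩ := hT.1.surjOn (⟨hpos, le_rfl⟩ : D.ncard ∈ Set.Icc 1 D.ncard)
    obtain ⟨h1, h2⟩ := update_zero_mem_extendedTableaux hD hc hT hTc
    refine ⟨⟨⟨c, (hM c).2 h1⟩, _, h2⟩, Subtype.ext ?_⟩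
    ext x
    by_cases hx : x = c
    · simp [hx, hTc]
    · simp [hx]

theorem numStandardTableaux_empty : numStandardTableaux ∅ = 1 := by
  rw [numStandardTableaux_eq_card]
  have : extendedTableaux ∅ = {fun _ => 0} := by
    ext T
    simp only [extendedTableaux, Set.mem_ofPred_eq, Set.mem_singleton_iff]
    constructor
    · rintro ⟨-, h, -⟩
      ext x
      exact h x (Set.notMem_empty x)
    · rintro rfl
      simp
  rw [this]
  simp

/-! ### Shifted shapes as finite sets of parts -/

/-- The strict partition obtained from `S` by replacing the part `s` by `s - 1`; a part `0` is
dropped. -/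
def moveDown (s : ℕ) (S : Finset ℕ) : Finset ℕ := (insert (s - 1) (S.erase s)).erase 0

/-- The sum of `h` over the strict partitions covered by `S`. -/
def downSum (h : Finset ℕ → ℚ) (S : Finset ℕ) : ℚ :=
  ∑ s ∈ S, if s - 1 ∈ S then 0 else h (moveDown s S)

/-- The number of cells on the diagonal `j - i = d` of the shifted diagram of `S`. -/
def diagLength (S : Finset ℕ) (d : ℕ) : ℕ := ∑ s ∈ S, if d < s then 1 else 0

/-- The shifted diagram of the strict partition with set of parts `S`. -/
def shiftedDiagram (S : Finset ℕ) : Set (ℕ × ℕ) :=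
  {c | c.1 ≤ c.2 ∧ c.1 < diagLength S (c.2 - c.1)}

/-- The last cell of the row of length `s`. -/
def rowEnd (S : Finset ℕ) (s : ℕ) : ℕ × ℕ := (diagLength S s, diagLength S s + (s - 1))

theorem zero_notMem_moveDown (s : ℕ) (S : Finset ℕ) : 0 ∉ moveDown s S := by
  simp [moveDown]

theorem mem_moveDown {s t : ℕ} {S : Finset ℕ} :
    t ∈ moveDown s S ↔ t ≠ 0 ∧ (t = s - 1 ∨ (t ≠ s ∧ t ∈ S)) := by
  simp [moveDown]

theorem moveDown_insert {s a : ℕ} {S : Finset ℕ} (ha : a ≠ 0) (has : a ≠ s) :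
    moveDown s (insert a S) = insert a (moveDown s S) := by
  rw [moveDown, moveDown, Finset.erase_insert_of_ne has, Finset.insert_comm,
    Finset.erase_insert_of_ne ha]

theorem moveDown_erase {s a : ℕ} {S : Finset ℕ} (has : s - 1 ≠ a) :
    moveDown s (S.erase a) = (moveDown s S).erase a := by
  rw [moveDown, moveDown, Finset.erase_right_comm, Finset.erase_right_comm (a := 0),
    Finset.erase_insert_of_ne has]

theorem sum_moveDown {s : ℕ} {S : Finset ℕ} (hs : s ∈ S) (hs' : s - 1 ∉ S) (f : ℕ → ℕ)
    (hf : f 0 = 0) : ∑ t ∈ moveDown s S, f t + f s = ∑ t ∈ S, f t + f (s - 1) := by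
  rw [moveDown, Finset.sum_erase _ hf, Finset.sum_insert (fun h => hs' (Finset.mem_of_mem_erase h)),
    ← Finset.add_sum_erase S f hs]
  ring

theorem diagLength_antitone (S : Finset ℕ) : Antitone (diagLength S) := by
  intro d e h
  refine Finset.sum_le_sum fun s _ => ?_
  split_ifs <;> omega

theorem diagLength_eq_succ_add (S : Finset ℕ) (d : ℕ) :
    diagLength S d = diagLength S (d + 1) + if d + 1 ∈ S then 1 else 0 := by
  rw [diagLength, diagLength, ← Finset.sum_ite_eq' S (d + 1) (fun _ => 1), ← Finset.sum_add_distrib]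
  refine Finset.sum_congr rfl fun s _ => ?_
  split_ifs <;> omega

theorem diagLength_insert {a : ℕ} {S : Finset ℕ} (h : a ∉ S) (d : ℕ) :
    diagLength (insert a S) d = (if d < a then 1 else 0) + diagLength S d :=
  Finset.sum_insert h

theorem diagLength_eq_zero {S : Finset ℕ} {d : ℕ} (h : ∀ s ∈ S, s ≤ d) : diagLength S d = 0 :=
  Finset.sum_eq_zero fun s hs => if_neg (h s hs).not_gt

theorem diagLength_moveDown {s : ℕ} {S : Finset ℕ} (h0 : 0 ∉ S) (hs : s ∈ S) (hs' : s - 1 ∉ S)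
    (d : ℕ) : diagLength (moveDown s S) d + (if d = s - 1 then 1 else 0) = diagLength S d := by
  have hpos : s ≠ 0 := by rintro rfl; exact h0 hs
  have h := sum_moveDown hs hs' (fun t => if d < t then 1 else 0) (by simp)
  simp only [diagLength]
  split_ifs at h ⊢ <;> omega

theorem finite_shiftedDiagram (S : Finset ℕ) : (shiftedDiagram S).Finite := by
  refine (((Finset.range (S.card + 1)) ×ˢ (Finset.range (S.card + 1 + S.sup id))).finite_toSet).subset
    ?_
  rintro ⟨i, j⟩ ⟨h1, h2⟩
  have hle : diagLength S (j - i) ≤ S.card := by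
    rw [Finset.card_eq_sum_ones]
    refine Finset.sum_le_sum fun s _ => ?_
    split_ifs <;> omega
  have hlt : j - i < S.sup id := by
    by_contra! h
    rw [diagLength_eq_zero fun s hs => (Finset.le_sup (f := id) hs).trans h] at h2
    omega
  simp only [Finset.coe_product, Finset.coe_range, Set.mem_prod, Set.mem_Iio]
  simp only at h1 h2
  omega

theorem isCornerCell_shiftedDiagram {S : Finset ℕ} (h0 : 0 ∉ S) (c : ℕ × ℕ) :
    IsCornerCell (shiftedDiagram S) c ↔ ∃ s ∈ S, s - 1 ∉ S ∧ rowEnd S s = c := by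
  obtain ⟨i, j⟩ := c
  constructor
  · rintro ⟨⟨h1, h2⟩, h3⟩
    simp only at h1 h2
    obtain ⟨d, rfl⟩ := Nat.exists_eq_add_of_le h1
    rw [Nat.add_sub_cancel_left] at h2
    have h4 : ¬ i < diagLength S (d + 1) := fun h => by
      have := (h3 (i, i + d + 1) ⟨by simp only; omega, by
        simp only; rwa [show i + d + 1 - i = d + 1 by omega]⟩).1 rfl
      simp only at this
      omega
    have h5 := diagLength_eq_succ_add S d
    have h6 : d + 1 ∈ S := by
      by_contra h
      rw [if_neg h] at h5
      omega
    rw [if_pos h6] at h5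
    refine ⟨d + 1, h6, fun h => ?_, ?_⟩
    · rcases d with _ | d
      · exact h0 h
      · have h7 := diagLength_eq_succ_add S d
        rw [if_pos (by exact h)] at h7
        have := (h3 (i + 1, i + (d + 1)) ⟨by simp only; omega, by
          simp only; rw [show i + (d + 1) - (i + 1) = d by omega]; omega⟩).2 rfl
        simp only at this
        omega
    · have : diagLength S (d + 1) = i := by omega
      simp [rowEnd, this]
  · rintro ⟨s, hs, hs', h⟩
    obtain ⟨d, rfl⟩ : ∃ d, s = d + 1 :=
      Nat.exists_eq_succ_of_ne_zero (by rintro rfl; exact h0 hs)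
    simp only [Nat.add_sub_cancel] at hs'
    simp only [rowEnd, Nat.add_sub_cancel, Prod.mk.injEq] at h
    obtain ⟨h1, h2⟩ := h
    rw [h1] at h2
    subst h2
    have h3 := diagLength_eq_succ_add S d
    rw [if_pos hs, h1] at h3
    refine ⟨⟨by simp, by simp [h3]⟩, ?_⟩
    rintro ⟨x, y⟩ ⟨h4, h5⟩
    simp only at h4 h5
    constructor
    · rintro rfl
      simp only
      by_contra! h
      have := diagLength_antitone S (show d + 1 ≤ y - x by omega)
      omega
    · rintro rfl
      simp only
      by_contra! h
      obtain ⟨e, rfl⟩ : ∃ e, d = e + 1 := ⟨d - 1, by omega⟩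
      have h6 := diagLength_eq_succ_add S e
      rw [if_neg hs'] at h6
      obtain ⟨k, rfl⟩ := Nat.exists_eq_add_of_lt h
      -- Diagonal lengths grow by at most one per step towards the main diagonal. As `s - 1` is not
      -- a part, the first step gives no growth, so no lower cell of the column is reached.
      have key : ∀ k e, k ≤ e → diagLength S (e - k) ≤ diagLength S e + k := by
        intro k
        induction k with
        | zero => simp
        | succ k ih =>
          intro e hk
          have h7 := ih e (by omega)
          have h8 := diagLength_eq_succ_add S (e - (k + 1))
          rw [show e - (k + 1) + 1 = e - k by omega] at h8
          split_ifs at h8 <;> omega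
      have := key k e (by omega)
      rw [show i + (e + 1) - (i + k + 1) = e - k by omega] at h5
      omega

theorem shiftedDiagram_sdiff_rowEnd {s : ℕ} {S : Finset ℕ} (h0 : 0 ∉ S) (hs : s ∈ S)
    (hs' : s - 1 ∉ S) : shiftedDiagram S \ {rowEnd S s} = shiftedDiagram (moveDown s S) := by
  ext ⟨i, j⟩
  simp only [shiftedDiagram, rowEnd, Set.mem_sdiff, Set.mem_ofPred_eq, Set.mem_singleton_iff,
    Prod.mk.injEq]
  have h1 := diagLength_moveDown h0 hs hs' (j - i)
  have hpos : s ≠ 0 := by rintro rfl; exact h0 hs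
  have h2 := diagLength_eq_succ_add S (s - 1)
  rw [Nat.sub_add_cancel (by omega), if_pos hs] at h2
  by_cases h : j - i = s - 1
  · rw [if_pos h] at h1
    rw [h] at h1 ⊢
    omega
  · rw [if_neg h] at h1
    omega

theorem rowEnd_injOn {S : Finset ℕ} (h0 : 0 ∉ S) : Set.InjOn (rowEnd S) S := by
  intro s hs t ht h
  simp only [rowEnd, Prod.mk.injEq] at h
  have hs0 : s ≠ 0 := by rintro rfl; exact h0 hs
  have ht0 : t ≠ 0 := by rintro rfl; exact h0 ht
  omega

theorem shiftedDiagram_empty : shiftedDiagram ∅ = ∅ := by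
  ext c
  simp [shiftedDiagram, diagLength]

/-- The number of standard tableaux of the shifted shape with set of parts `S`. -/
noncomputable def shiftedCount (S : Finset ℕ) : ℚ := numStandardTableaux (shiftedDiagram S)

theorem shiftedCount_empty : shiftedCount ∅ = 1 := by
  simp [shiftedCount, shiftedDiagram_empty, numStandardTableaux_empty]

theorem sum_filter_rowEnd {S : Finset ℕ} (h0 : 0 ∉ S) (f : ℕ × ℕ → ℚ) :
    ∑ c ∈ (S.filter (fun s => s - 1 ∉ S)).image (rowEnd S), f c =
      ∑ s ∈ S, if s - 1 ∈ S then 0 else f (rowEnd S s) := by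
  rw [Finset.sum_image ((rowEnd_injOn h0).mono (Finset.coe_subset.2 (Finset.filter_subset _ _))),
    Finset.sum_filter]
  refine Finset.sum_congr rfl fun s _ => ?_
  split_ifs <;> rfl

theorem shiftedCount_eq_downSum {S : Finset ℕ} (h0 : 0 ∉ S) (hne : S.Nonempty) :
    shiftedCount S = downSum shiftedCount S := by
  have hne' : (shiftedDiagram S).Nonempty := by
    obtain ⟨s, hs⟩ := hne
    refine ⟨(0, 0), le_rfl, ?_⟩
    refine (Finset.sum_pos' (fun _ _ => Nat.zero_le _) ⟨s, hs, ?_⟩)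
    have : s ≠ 0 := by rintro rfl; exact h0 hs
    rw [if_pos (by simp only; omega)]
    exact one_pos
  rw [shiftedCount, numStandardTableaux_eq_sum_corners (finite_shiftedDiagram S) hne'
    ((S.filter (fun s => s - 1 ∉ S)).image (rowEnd S)) (fun c => by
      rw [isCornerCell_shiftedDiagram h0]; simp [and_assoc])]
  push_cast
  rw [sum_filter_rowEnd h0 fun c => (numStandardTableaux (shiftedDiagram S \ {c}) : ℚ), downSum]
  refine Finset.sum_congr rfl fun s hs => ?_
  split_ifs with h
  · rfl
  · rw [shiftedDiagram_sdiff_rowEnd h0 hs h, shiftedCount]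

theorem shiftedTruncatedDiagram_zero (n : ℕ) :
    shiftedTruncatedDiagram (staircase n) (staircase 0) = shiftedDiagram (Finset.Icc 1 n) := by
  have h : ∀ d, diagLength (Finset.Icc 1 n) d = n - d := by
    intro d
    rw [diagLength, ← Finset.sum_filter, ← Finset.card_eq_sum_ones,
      show (Finset.Icc 1 n).filter (d < ·) = Finset.Ioc d n by ext; simp; omega, Nat.card_Ioc]
  ext ⟨i, j⟩
  simp only [shiftedTruncatedDiagram, shiftedDiagram, staircase, Set.mem_ofPred_eq, h]
  omega

/-! ### The recursion for the truncated shape -/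

/-- The truncated shape with rows `m, m` and `μ`, the first row being shortened by one cell. -/
def truncatedDiagram (m : ℕ) (μ : Finset ℕ) : Set (ℕ × ℕ) :=
  shiftedDiagram (insert (m + 1) (insert m μ)) \ {(0, m)}

noncomputable def truncatedCount (m : ℕ) (μ : Finset ℕ) : ℚ :=
  numStandardTableaux (truncatedDiagram m μ)

theorem shiftedTruncatedDiagram_one (m : ℕ) (hm : 2 ≤ m) :
    shiftedTruncatedDiagram (staircase (m + 1)) (staircase 1) =
      truncatedDiagram m (Finset.Icc 1 (m - 1)) := by
  have h : insert (m + 1) (insert m (Finset.Icc 1 (m - 1))) = Finset.Icc 1 (m + 1) := by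
    ext
    simp
    omega
  rw [truncatedDiagram, h, ← shiftedTruncatedDiagram_zero]
  ext ⟨i, j⟩
  simp only [shiftedTruncatedDiagram, staircase, Set.mem_ofPred_eq, Set.mem_sdiff,
    Set.mem_singleton_iff, Prod.mk.injEq]
  omega

/-- The deleted cell `(0, m)` has `(1, m)` below it, so it was no corner. Deleting it could only
expose `(0, m - 1)`, and that cell has `(1, m - 1)` below it because `2 ≤ m`. -/
theorem isCornerCell_truncatedDiagram {m : ℕ} (hm : 2 ≤ m) {μ : Finset ℕ}
    (hμ : ∀ s ∈ μ, s < m) (c : ℕ × ℕ) :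
    IsCornerCell (truncatedDiagram m μ) c ↔
      IsCornerCell (shiftedDiagram (insert (m + 1) (insert m μ))) c := by
  have hmμ : m ∉ μ := fun h => (hμ m h).false
  have hm1 : m + 1 ∉ insert m μ := by
    simp only [Finset.mem_insert, not_or]
    exact ⟨by omega, fun h => by have := hμ _ h; omega⟩
  have hlen : ∀ d, diagLength (insert (m + 1) (insert m μ)) d =
      (if d < m + 1 then 1 else 0) + ((if d < m then 1 else 0) + diagLength μ d) := fun d => by
    rw [diagLength_insert hm1, diagLength_insert hmμ]
  have hbelow : (1, m) ∈ shiftedDiagram (insert (m + 1) (insert m μ)) := by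
    refine ⟨by simp only; omega, ?_⟩
    simp only [hlen]
    rw [if_pos (by omega), if_pos (by omega)]
    omega
  constructor
  · rintro ⟨⟨h1, h2⟩, h3⟩
    refine ⟨h1, fun x hx => ?_⟩
    by_cases hx0 : x = (0, m)
    · subst hx0
      refine ⟨fun h => ?_, fun _ => Nat.zero_le _⟩
      by_contra! hlt
      obtain ⟨i, j⟩ := c
      simp only at h hlt
      subst h
      rcases Nat.eq_zero_or_pos j with rfl | hj
      · have := (h3 (0, 1) ⟨⟨by simp, by
          simp only [hlen]; rw [if_pos (by omega)]; omega⟩, by simp; omega⟩).1 rfl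
        simp only at this
        omega
      · have := (h3 (1, j) ⟨⟨by simp only; omega, by
          simp only [hlen]
          rw [if_pos (by omega), if_pos (by omega)]
          omega⟩, by simp⟩).2 rfl
        simp only at this
        omega
    · exact h3 x ⟨hx, hx0⟩
  · rintro ⟨h1, h2⟩
    refine ⟨⟨h1, ?_⟩, fun x hx => h2 x hx.1⟩
    rintro rfl
    have := (h2 _ hbelow).2 rfl
    simp only at this
    omega

/-- Lowering a part of `μ` keeps the shape in the same family and gives the `downSum`. The other
possible corner ends the row of length `m`. Once it is gone, the missing cell `(0, m)` is an honest
row end of the remaining shifted shape, and deleting it leaves the shifted shape with parts `m`, `m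
- 1` and `μ`. -/
theorem truncatedCount_eq {m : ℕ} (hm : 2 ≤ m) {μ : Finset ℕ} (h0 : 0 ∉ μ)
    (hμ : ∀ s ∈ μ, s < m) :
    truncatedCount m μ = downSum (truncatedCount m) μ +
      if m - 1 ∈ μ then 0 else shiftedCount (insert m (insert (m - 1) μ)) := by
  have hmμ : m ∉ μ := fun h => (hμ m h).false
  have hm1 : m + 1 ∉ insert m μ := by
    simp only [Finset.mem_insert, not_or]
    exact ⟨by omega, fun h => by have := hμ _ h; omega⟩
  set S := insert (m + 1) (insert m μ) with hS
  have hS0 : 0 ∉ S := by simp [hS, h0]; omega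
  have hne : (truncatedDiagram m μ).Nonempty := by
    refine ⟨(0, 0), ⟨by simp, ?_⟩, by simp; omega⟩
    simp only [diagLength_insert hm1]
    rw [if_pos (by omega)]
    omega
  have hrow : ∀ {s}, s ∈ S → s - 1 ∉ S →
      truncatedDiagram m μ \ {rowEnd S s} = shiftedDiagram (moveDown s S) \ {(0, m)} := by
    intro s hs hs'
    rw [truncatedDiagram, ← shiftedDiagram_sdiff_rowEnd hS0 hs hs']
    exact Set.sdiff_sdiff_comm
  rw [truncatedCount, numStandardTableaux_eq_sum_corners (D := truncatedDiagram m μ)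
    ((finite_shiftedDiagram S).subset Set.sdiff_subset) hne
    ((S.filter (fun s => s - 1 ∉ S)).image (rowEnd S)) (fun c => by
      rw [isCornerCell_truncatedDiagram hm hμ, isCornerCell_shiftedDiagram hS0]; simp [and_assoc])]
  push_cast
  rw [sum_filter_rowEnd hS0 fun c => (numStandardTableaux (truncatedDiagram m μ \ {c}) : ℚ)]
  rw [hS, Finset.sum_insert hm1, Finset.sum_insert hmμ, ← hS]
  -- The part `m + 1` contributes nothing, being blocked by `m`.
  rw [if_pos (by simp [hS]), zero_add, add_comm]
  congr 1
  · refine Finset.sum_congr rfl fun s hs => ?_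
    have hsm := hμ s hs
    have hiff : s - 1 ∈ S ↔ s - 1 ∈ μ := by
      simp only [hS, Finset.mem_insert]
      constructor
      · rintro (h | h | h)
        · omega
        · omega
        · exact h
      · tauto
    simp only [hiff]
    split_ifs with h
    · rfl
    · rw [hrow (by simp [hS, hs]) (by rwa [hiff]), truncatedCount, truncatedDiagram]
      rw [hS, moveDown_insert (by omega) (by omega), moveDown_insert (by omega) (by omega)]
  · have hiff : m - 1 ∈ S ↔ m - 1 ∈ μ := by
      simp only [hS, Finset.mem_insert]
      constructor
      · rintro (h | h | h)
        · omega
        · omega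
        · exact h
      · tauto
    simp only [hiff]
    split_ifs with h
    · rfl
    · rw [hrow (by simp [hS]) (by rwa [hiff]), shiftedCount]
      have hmem : m + 1 ∈ moveDown m S := by
        rw [mem_moveDown]
        simp [hS]
      have hend : rowEnd (moveDown m S) (m + 1) = (0, m) := by
        have : diagLength (moveDown m S) (m + 1) = 0 := by
          refine diagLength_eq_zero fun s hs => ?_
          rw [mem_moveDown] at hs
          simp only [hS, Finset.mem_insert] at hs
          rcases hs with ⟨-, h | ⟨-, h | h | h⟩⟩
          · omega
          · omega
          · omega
          · have := hμ s h
            omega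
        simp [rowEnd, this]
      rw [← hend, shiftedDiagram_sdiff_rowEnd (zero_notMem_moveDown _ _) hmem (by
        rw [mem_moveDown]; simp; omega)]
      have : moveDown (m + 1) (moveDown m S) = insert m (insert (m - 1) μ) := by
        ext t
        simp only [hS, Finset.mem_insert, mem_moveDown]
        have h0t : t ∈ μ → t ≠ 0 := by rintro h rfl; exact h0 h
        have hmt : t ∈ μ → t < m := hμ t
        clear_value S
        clear hrow hS hend hmem hiff
        by_cases htμ : t ∈ μ
        · have := h0t htμ
          have := hmt htμ
          simp only [htμ, or_true, and_true, iff_true]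
          omega
        · simp only [htμ, or_false]
          omega
      rw [this]

/-! ### Neutral fermions and their commutators with `downSum` -/

/-- The sign of moving a part `b` past the larger parts of `μ`. -/
def passSign (b : ℕ) (μ : Finset ℕ) : ℚ := ∏ t ∈ μ, if b < t then -1 else 1

/-- The action of a neutral fermion on functions of strict partitions: creation of the part `b`
if `0 < b`, annihilation of the part `-b` if `b < 0`. -/
def fermion : ℤ → (Finset ℕ → ℚ) → Finset ℕ → ℚ
  | .ofNat 0, h, μ => passSign 0 μ * h μ
  | .ofNat (b + 1), h, μ => if b + 1 ∈ μ then 0 else passSign (b + 1) μ * h (insert (b + 1) μ)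
  | .negSucc j, h, μ =>
      if j + 1 ∈ μ then 2 * (-1) ^ (j + 1) * passSign (j + 1) μ * h (μ.erase (j + 1)) else 0

theorem prod_moveDown {s : ℕ} {S : Finset ℕ} (hs : s ∈ S) (hs' : s - 1 ∉ S) (f : ℕ → ℚ)
    (hf : f 0 = 1) : (∏ t ∈ moveDown s S, f t) * f s = (∏ t ∈ S, f t) * f (s - 1) := by
  rw [moveDown, Finset.prod_erase _ hf,
    Finset.prod_insert (fun h => hs' (Finset.mem_of_mem_erase h)), ← Finset.mul_prod_erase S f hs]
  ring

/-- Lowering `s` to `s - 1` alters the comparison with `b` only when `s = b + 1`; a dropped part `0`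
carries the factor `1`. -/
theorem passSign_moveDown {b s : ℕ} {μ : Finset ℕ} (h0 : 0 ∉ μ) (hs : s ∈ μ) (hs' : s - 1 ∉ μ)
    (hb : s ≠ b + 1) : passSign b (moveDown s μ) = passSign b μ := by
  have h := prod_moveDown hs hs' (fun t => if b < t then -1 else 1) (by simp)
  have hpos : s ≠ 0 := by rintro rfl; exact h0 hs
  simp only [passSign]
  split_ifs at h with h1 h2 h2
  · linarith
  · omega
  · omega
  · linarith

theorem passSign_moveDown_self {b : ℕ} {μ : Finset ℕ} (hs : b + 1 ∈ μ) (hs' : b ∉ μ) :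
    passSign b (moveDown (b + 1) μ) = -passSign b μ := by
  have h := prod_moveDown hs (by simpa using hs') (fun t => if b < t then -1 else 1) (by simp)
  simp only [passSign]
  simp at h
  linarith

theorem passSign_eq_succ_mul (b : ℕ) (μ : Finset ℕ) :
    passSign b μ = passSign (b + 1) μ * if b + 1 ∈ μ then -1 else 1 := by
  rw [passSign, passSign, ← Finset.prod_ite_eq' μ (b + 1) (fun _ => (-1 : ℚ)),
    ← Finset.prod_mul_distrib]
  refine Finset.prod_congr rfl fun s _ => ?_
  split_ifs <;> first | omega | norm_num

theorem moveDown_succ_of_mem {b : ℕ} {μ : Finset ℕ} (h0 : 0 ∉ μ) (hb : b ≠ 0) :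
    moveDown (b + 1) μ = insert b (μ.erase (b + 1)) := by
  rw [moveDown, Nat.add_sub_cancel, Finset.erase_eq_of_notMem]
  simp [h0]
  omega

theorem moveDown_one {μ : Finset ℕ} (h0 : 0 ∉ μ) : moveDown 1 μ = μ.erase 1 := by
  rw [moveDown, Nat.sub_self, Finset.erase_insert]
  simp [h0]

theorem fermion_zero (h : Finset ℕ → ℚ) (μ : Finset ℕ) :
    fermion 0 h μ = passSign 0 μ * h μ := rfl

theorem fermion_succ (b : ℕ) (h : Finset ℕ → ℚ) (μ : Finset ℕ) :
    fermion ((b + 1 : ℕ) : ℤ) h μ =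
      if b + 1 ∈ μ then 0 else passSign (b + 1) μ * h (insert (b + 1) μ) := rfl

theorem fermion_negSucc (j : ℕ) (h : Finset ℕ → ℚ) (μ : Finset ℕ) :
    fermion (.negSucc j) h μ = if j + 1 ∈ μ then
      2 * (-1) ^ (j + 1) * passSign (j + 1) μ * h (μ.erase (j + 1)) else 0 := rfl

theorem moveDown_succ_insert {b : ℕ} {μ : Finset ℕ} (hb : b + 1 ∉ μ) :
    moveDown (b + 1) (insert (b + 1) μ) = (insert b μ).erase 0 := by
  rw [moveDown, Finset.erase_insert hb, Nat.add_sub_cancel]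

theorem insert_moveDown_succ {b : ℕ} {μ : Finset ℕ} (hb : b + 1 ∈ μ) :
    insert (b + 1) (moveDown (b + 1) μ) = (insert b μ).erase 0 := by
  rw [moveDown, Nat.add_sub_cancel, ← Finset.erase_insert_of_ne (Nat.succ_ne_zero b),
    Finset.insert_comm, Finset.insert_erase hb]

/-- Creation of the part `b` expressed through `(insert b μ).erase 0`, uniformly in `b`. -/
theorem fermion_natCast (b : ℕ) (h : Finset ℕ → ℚ) {μ : Finset ℕ} (h0 : 0 ∉ μ) :
    fermion (b : ℤ) h μ = if b ∈ μ then 0 else passSign b μ * h ((insert b μ).erase 0) := by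
  rcases b with _ | b
  · rw [if_neg h0, Finset.erase_insert h0]
    rfl
  · rw [fermion_succ, Finset.erase_eq_of_notMem (a := 0) (by simp [h0])]

/-- The commutator of `downSum` with the creation of a part. -/
theorem fermion_downSum_succ (h : Finset ℕ → ℚ) (b : ℕ) {μ : Finset ℕ} (h0 : 0 ∉ μ) :
    fermion ((b + 1 : ℕ) : ℤ) (downSum h) μ =
      fermion (b : ℤ) h μ + downSum (fermion ((b + 1 : ℕ) : ℤ) h) μ := by
  rw [fermion_succ, fermion_natCast b h h0, passSign_eq_succ_mul b μ]
  by_cases hb : b + 1 ∈ μ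
  -- The left side is zero. On the right only lowering `b + 1` itself makes room for a new part `b +
  -- 1`, and that term cancels the creation of `b`, since `passSign b μ = -passSign (b + 1) μ`.
  · rw [if_pos hb, if_pos hb, downSum, Finset.sum_eq_single_of_mem (b + 1) hb]
    · rw [Nat.add_sub_cancel]
      split_ifs with hb'
      · simp
      · rw [fermion_succ, if_neg (by simp [mem_moveDown]),
          passSign_moveDown h0 hb (by simpa using hb') (by omega), insert_moveDown_succ hb]
        ring
    · intro s hs hsb
      rw [fermion_succ, if_pos (mem_moveDown.2 ⟨by omega, Or.inr ⟨hsb.symm, hb⟩⟩), ite_self]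
  · rw [if_neg hb, if_neg hb, downSum, downSum, Finset.sum_insert hb, mul_add, mul_one]
    congr 1
    · rw [moveDown_succ_insert hb]
      simp
    · rw [Finset.mul_sum]
      refine Finset.sum_congr rfl fun s hs => ?_
      have hsb : b + 1 ≠ s := by rintro rfl; exact hb hs
      by_cases hs1 : s - 1 ∈ μ
      · simp [hs1]
      · rw [if_neg hs1, fermion_succ, moveDown_insert (by omega) hsb]
        by_cases hs2 : b + 1 = s - 1
        · rw [if_pos (by simp [hs2]), if_pos (mem_moveDown.2 ⟨by omega, Or.inl hs2⟩), mul_zero]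
        · rw [if_neg (by simp [hs1, Ne.symm hs2]), if_neg (by simp [mem_moveDown, hb, hs2]),
            passSign_moveDown h0 hs hs1 (by omega)]

/-- The commutator of `downSum` with the sign operator. -/
theorem fermion_downSum_zero (h : Finset ℕ → ℚ) {μ : Finset ℕ} (h0 : 0 ∉ μ) :
    fermion 0 (downSum h) μ = fermion (.negSucc 0) h μ + downSum (fermion 0 h) μ := by
  -- Only the removal of a part `1` changes the number of parts and so the sign. The difference of
  -- the two opposite signs is the factor `2` in the annihilation operators.
  have hterm : ∀ s ∈ μ, passSign 0 μ * (if s - 1 ∈ μ then 0 else h (moveDown s μ)) =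
      (if s = 1 then 2 * passSign 0 μ * h (μ.erase 1) else 0) +
        if s - 1 ∈ μ then 0 else fermion 0 h (moveDown s μ) := by
    intro s hs
    by_cases h1 : s = 1
    · subst h1
      rw [if_neg (by simpa), if_pos rfl, if_neg (by simpa), fermion_zero,
        passSign_moveDown_self (b := 0) hs h0, moveDown_one h0]
      ring
    · by_cases hs1 : s - 1 ∈ μ
      · simp [h1, hs1]
      · rw [if_neg hs1, if_neg h1, if_neg hs1, fermion_zero,
          passSign_moveDown h0 hs hs1 (by omega), zero_add]
  rw [fermion_zero, downSum, Finset.mul_sum, Finset.sum_congr rfl hterm, Finset.sum_add_distrib,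
    Finset.sum_ite_eq', fermion_negSucc, passSign_eq_succ_mul 0 μ, downSum]
  congr 1
  simp only [zero_add]
  split_ifs
  · ring
  · rfl

/-- The commutator of `downSum` with the annihilation of a part. -/
theorem fermion_downSum_negSucc (h : Finset ℕ → ℚ) (j : ℕ) {μ : Finset ℕ} (h0 : 0 ∉ μ) :
    fermion (.negSucc j) (downSum h) μ =
      fermion (.negSucc (j + 1)) h μ + downSum (fermion (.negSucc j) h) μ := by
  rw [fermion_negSucc, fermion_negSucc]
  by_cases hj : j + 1 ∈ μ
  · have hterm : ∀ s ∈ μ.erase (j + 1),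
        2 * (-1) ^ (j + 1) * passSign (j + 1) μ *
          (if s - 1 ∈ μ.erase (j + 1) then 0 else h (moveDown s (μ.erase (j + 1)))) =
        (if s = j + 1 + 1 then
          2 * (-1) ^ (j + 1) * passSign (j + 1) μ * h (μ.erase (j + 1 + 1)) else 0) +
          if s - 1 ∈ μ then 0 else fermion (.negSucc j) h (moveDown s μ) := by
      intro s hs
      obtain ⟨hsj, hs⟩ := Finset.mem_erase.1 hs
      -- Lowering `j + 2` is blocked by `j + 1` in `μ` but allowed after `j + 1` has been erased.
      -- This extra term is the annihilation of `j + 2`.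
      by_cases h1 : s = j + 1 + 1
      · subst h1
        rw [if_neg (by simp), if_pos rfl, if_pos (by simpa using hj), add_zero,
          moveDown_succ_of_mem (by simp [h0]) (by omega), Finset.erase_right_comm,
          Finset.insert_erase (by simp [hj])]
      · have h2 : s - 1 ≠ j + 1 := by omega
        simp only [Finset.mem_erase, ne_eq, h2, not_false_eq_true, true_and, if_neg h1, zero_add]
        by_cases hs1 : s - 1 ∈ μ
        · simp [hs1]
        · rw [if_neg hs1, if_neg hs1, fermion_negSucc,
            if_pos (mem_moveDown.2 ⟨by omega, Or.inr ⟨hsj.symm, hj⟩⟩),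
            passSign_moveDown h0 hs hs1 h1, moveDown_erase h2]
    rw [if_pos hj, downSum, Finset.mul_sum, Finset.sum_congr rfl hterm, Finset.sum_add_distrib,
      Finset.sum_ite_eq', downSum, ← Finset.add_sum_erase μ _ hj]
    have hself : fermion (.negSucc j) h (moveDown (j + 1) μ) = 0 := by
      rw [fermion_negSucc, if_neg (by simp [mem_moveDown])]
    rw [hself, ite_self, zero_add]
    congr 1
    simp only [Finset.mem_erase, passSign_eq_succ_mul (j + 1) μ]
    by_cases h2 : j + 1 + 1 ∈ μ
    · simp only [h2, if_true]
      rw [if_pos (by simp)]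
      ring
    · simp [h2]
  · rw [if_neg hj, downSum]
    have hterm : ∀ s ∈ μ, (if s - 1 ∈ μ then 0 else fermion (.negSucc j) h (moveDown s μ)) =
        if s = j + 1 + 1 then
          2 * (-1) ^ (j + 1) * -passSign (j + 1) μ * h (μ.erase (j + 1 + 1)) else 0 := by
      intro s hs
      by_cases h1 : s = j + 1 + 1
      · subst h1
        rw [if_neg (by simpa using hj), if_pos rfl, fermion_negSucc,
          if_pos (mem_moveDown.2 ⟨by omega, Or.inl (by omega)⟩),
          passSign_moveDown_self hs hj, moveDown_succ_of_mem h0 (by omega),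
          Finset.erase_insert (by simp [hj])]
      · rw [if_neg h1, fermion_negSucc, if_neg (c := j + 1 ∈ moveDown s μ), ite_self]
        rw [mem_moveDown]
        rintro ⟨-, h3 | h3⟩
        · omega
        · exact hj h3.2
    rw [Finset.sum_congr rfl hterm, Finset.sum_ite_eq', passSign_eq_succ_mul (j + 1) μ]
    split_ifs
    · ring
    · simp

/-- The sign operator at `b = 0` joins creation to annihilation, so one commutation rule holds for
all integers `b`. This is what lets the later telescoping run through zero. -/
theorem fermion_downSum (h : Finset ℕ → ℚ) (b : ℤ) {μ : Finset ℕ} (h0 : 0 ∉ μ) :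
    fermion b (downSum h) μ = fermion (b - 1) h μ + downSum (fermion b h) μ := by
  match b with
  | .ofNat 0 => exact fermion_downSum_zero h h0
  | .ofNat (b + 1) =>
    rw [show (Int.ofNat (b + 1) - 1 : ℤ) = (b : ℤ) by simp]
    exact fermion_downSum_succ h b h0
  | .negSucc j =>
    rw [show (Int.negSucc j - 1 : ℤ) = Int.negSucc (j + 1) by omega]
    exact fermion_downSum_negSucc h j h0

theorem fermion_congr {m : ℕ} {b : ℤ} (hb : b < m) {h h₁ : Finset ℕ → ℚ} {μ : Finset ℕ}
    (h0 : 0 ∉ μ) (hμ : ∀ s ∈ μ, s < m)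
    (heq : ∀ ν : Finset ℕ, 0 ∉ ν → (∀ s ∈ ν, s < m) → h ν = h₁ ν) :
    fermion b h μ = fermion b h₁ μ := by
  match b with
  | .ofNat 0 => rw [Int.ofNat_eq_natCast, Nat.cast_zero, fermion_zero, fermion_zero, heq μ h0 hμ]
  | .ofNat (b + 1) =>
    have hb' : b + 1 < m := by
      have : ((b + 1 : ℕ) : ℤ) < m := hb
      omega
    rw [Int.ofNat_eq_natCast, fermion_succ, fermion_succ,
      heq (insert (b + 1) μ) (by simp [h0]) (by simpa [hb'] using hμ)]
  | .negSucc j =>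
    rw [fermion_negSucc, fermion_negSucc,
      heq _ (by simp [h0]) (fun s hs => hμ s (Finset.mem_of_mem_erase hs))]

theorem fermion_add (b : ℤ) (h h₁ : Finset ℕ → ℚ) (μ : Finset ℕ) :
    fermion b (fun ν => h ν + h₁ ν) μ = fermion b h μ + fermion b h₁ μ := by
  match b with
  | .ofNat 0 => exact mul_add _ _ _
  | .ofNat (b + 1) =>
    simp only [Int.ofNat_eq_natCast, fermion_succ]
    split_ifs
    · simp
    · ring
  | .negSucc j =>
    simp only [fermion_negSucc]
    split_ifs
    · ring
    · simp

/-! ### The alternating sum solves the truncated recursion -/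

/-- The number of standard tableaux of shifted shape, with one part `a` split off. -/
noncomputable def shiftedCountInsert (a : ℕ) (ν : Finset ℕ) : ℚ := shiftedCount (insert a ν)

/-- Every part of `ν` is smaller than `a`, so lowering the large part is never blocked, and lowering
a part of `ν` does not interact with it. -/
theorem shiftedCountInsert_succ {m a : ℕ} (ha : m ≤ a) (hm : 1 ≤ m) {ν : Finset ℕ} (h0 : 0 ∉ ν)
    (hν : ∀ s ∈ ν, s < m) :
    shiftedCountInsert (a + 1) ν =
      shiftedCountInsert a ν + downSum (shiftedCountInsert (a + 1)) ν := by
  have hlt : ∀ t, m ≤ t → t ∉ ν := fun t ht h => by have := hν t h; omega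
  rw [shiftedCountInsert, shiftedCount_eq_downSum (by simp [h0]) (Finset.insert_nonempty _ _),
    downSum, Finset.sum_insert (hlt _ (by omega)), Nat.add_sub_cancel,
    if_neg (by simp [hlt a ha]), moveDown_succ_insert (hlt _ (by omega)),
    Finset.erase_eq_of_notMem (by simp [h0]; omega), downSum]
  congr 1
  refine Finset.sum_congr rfl fun s hs => ?_
  have := hν s hs
  rw [moveDown_insert (by omega) (by omega)]
  simp only [Finset.mem_insert, show s - 1 ≠ a + 1 by omega, false_or]
  rfl

/-- The alternating sum that counts the standard tableaux of the truncated shape. -/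
noncomputable def alternatingCount (m : ℕ) (μ : Finset ℕ) : ℚ :=
  ∑ k ∈ Finset.range (2 * m - 1),
    (-1) ^ k * fermion ((m : ℤ) - 1 - k) (shiftedCountInsert (m + 1 + k)) μ

theorem sum_alternating_telescope (A : ℕ → ℚ) (n : ℕ) :
    ∑ k ∈ Finset.range n, (-1) ^ k * (A k + A (k + 1)) = A 0 - (-1) ^ n * A n := by
  induction n with
  | zero => simp
  | succ n ih =>
    rw [Finset.sum_range_succ, ih, pow_succ]
    ring

theorem downSum_sum {ι : Type*} (I : Finset ι) (c : ι → ℚ) (h : ι → Finset ℕ → ℚ)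
    (μ : Finset ℕ) :
    downSum (fun ν => ∑ k ∈ I, c k * h k ν) μ = ∑ k ∈ I, c k * downSum (h k) μ := by
  simp only [downSum, Finset.mul_sum]
  rw [Finset.sum_comm]
  refine Finset.sum_congr rfl fun s _ => ?_
  split_ifs <;> simp

/-- Each summand splits as `A k + A (k + 1)` plus a `downSum`, and the alternating signs telescope
the `A` terms to `A 0`. -/
theorem alternatingCount_eq {m : ℕ} (hm : 2 ≤ m) {μ : Finset ℕ} (h0 : 0 ∉ μ)
    (hμ : ∀ s ∈ μ, s < m) :
    alternatingCount m μ = downSum (alternatingCount m) μ +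
      if m - 1 ∈ μ then 0 else shiftedCount (insert m (insert (m - 1) μ)) := by
  set A : ℕ → ℚ := fun k => fermion ((m : ℤ) - 1 - k) (shiftedCountInsert (m + k)) μ with hA
  have hstep : ∀ k : ℕ, fermion ((m : ℤ) - 1 - k) (shiftedCountInsert (m + 1 + k)) μ =
      (A k + A (k + 1)) +
        downSum (fermion ((m : ℤ) - 1 - k) (shiftedCountInsert (m + 1 + k))) μ := by
    intro k
    rw [fermion_congr (m := m) (h₁ := fun ν => shiftedCountInsert (m + k) ν +
        downSum (shiftedCountInsert (m + 1 + k)) ν) (by omega) h0 hμ, fermion_add,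
      fermion_downSum _ _ h0, hA]
    · simp only
      rw [show (m : ℤ) - 1 - ((k + 1 : ℕ) : ℤ) = (m : ℤ) - 1 - k - 1 by push_cast; ring,
        show m + (k + 1) = m + 1 + k by ring]
      ring
    · intro ν h0 hν
      rw [show m + 1 + k = m + k + 1 by ring]
      exact shiftedCountInsert_succ (by omega) (by omega) h0 hν
  have hsign : passSign (m - 1) μ = 1 :=
    Finset.prod_eq_one fun s hs => if_neg (by have := hμ s hs; omega)
  have hA0 : A 0 = if m - 1 ∈ μ then 0 else shiftedCount (insert m (insert (m - 1) μ)) := by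
    rw [hA]
    simp only
    rw [show (m : ℤ) - 1 - ((0 : ℕ) : ℤ) = ((m - 2 + 1 : ℕ) : ℤ) by omega, fermion_succ,
      show m - 2 + 1 = m - 1 by omega, hsign, one_mul]
    rfl
  -- The index has reached `-m`, and `μ` has no part `m` to annihilate. This fixes the length of the
  -- sum.
  have hlast : A (2 * m - 1) = 0 := by
    rw [hA]
    simp only
    rw [show (m : ℤ) - 1 - ((2 * m - 1 : ℕ) : ℤ) = .negSucc (m - 1) by omega, fermion_negSucc,
      if_neg]
    intro h
    have := hμ _ h
    omega
  have hdown : downSum (alternatingCount m) μ = ∑ k ∈ Finset.range (2 * m - 1),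
      (-1) ^ k * downSum (fermion ((m : ℤ) - 1 - k) (shiftedCountInsert (m + 1 + k))) μ :=
    downSum_sum _ _ _ μ
  rw [hdown, alternatingCount, ← hA0]
  have htel := sum_alternating_telescope A (2 * m - 1)
  rw [hlast, mul_zero, sub_zero] at htel
  rw [← htel, ← Finset.sum_add_distrib]
  refine Finset.sum_congr rfl fun k _ => ?_
  rw [← mul_add, hstep k]
  ring

theorem sum_id_moveDown {s : ℕ} {S : Finset ℕ} (h0 : 0 ∉ S) (hs : s ∈ S) (hs' : s - 1 ∉ S) :
    ∑ t ∈ moveDown s S, t + 1 = ∑ t ∈ S, t := by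
  have h := sum_moveDown hs hs' (fun t => t) rfl
  have hpos : s ≠ 0 := by rintro rfl; exact h0 hs
  omega

theorem truncatedCount_eq_alternatingCount {m : ℕ} (hm : 2 ≤ m) :
    ∀ (N : ℕ) (μ : Finset ℕ), ∑ t ∈ μ, t = N → 0 ∉ μ → (∀ s ∈ μ, s < m) →
      truncatedCount m μ = alternatingCount m μ := by
  intro N
  induction N with
  | zero =>
    intro μ hN h0 hμ
    have : μ = ∅ := Finset.eq_empty_of_forall_notMem fun t ht => h0 (by
      rwa [Finset.sum_eq_zero_iff.1 hN t ht] at ht)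
    rw [truncatedCount_eq hm h0 hμ, alternatingCount_eq hm h0 hμ, this]
    simp [downSum]
  | succ N ih =>
    intro μ hN h0 hμ
    rw [truncatedCount_eq hm h0 hμ, alternatingCount_eq hm h0 hμ]
    congr 1
    refine Finset.sum_congr rfl fun s hs => ?_
    split_ifs with hs'
    · rfl
    · refine ih _ ?_ (zero_notMem_moveDown _ _) ?_
      · have := sum_id_moveDown h0 hs hs'
        omega
      · intro t ht
        have := hμ s hs
        rcases (mem_moveDown.1 ht).2 with h | h
        · omega
        · exact hμ t h.2

/-! ### The product formula for shifted shapes -/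

/-- Let `P` and `Q` be the monic polynomials with roots `v t + w t` and `v t`. The coefficient of `P
- Q` just below the top degree is `-∑ w`; Lagrange interpolation at the points `v s`, where `Q`
vanishes, expresses it as minus the left side. -/
theorem sum_mul_prod_one_sub_div {ι : Type*} [DecidableEq ι] (S : Finset ι) (v w : ι → ℚ)
    (hv : Set.InjOn v S) :
    ∑ s ∈ S, w s * ∏ t ∈ S.erase s, (1 - w t / (v s - v t)) = ∑ s ∈ S, w s := by
  open Polynomial in
  rcases S.eq_empty_or_nonempty with rfl | hne
  · simp
  set P : ℚ[X] := ∏ t ∈ S, (X - C (v t + w t)) with hP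
  set Q : ℚ[X] := ∏ t ∈ S, (X - C (v t)) with hQ
  have hPm : P.Monic := monic_prod_of_monic _ _ fun i _ => monic_X_sub_C _
  have hQm : Q.Monic := monic_prod_of_monic _ _ fun i _ => monic_X_sub_C _
  have hPd : P.degree = S.card := by
    rw [hP, degree_prod]
    simp only [degree_X_sub_C, Finset.sum_const, nsmul_eq_mul, mul_one]
  have hQd : Q.degree = S.card := by
    rw [hQ, degree_prod]
    simp
  have hdeg : (P - Q).degree < S.card := by
    rw [← hPd]
    exact degree_sub_lt_left (hPd.trans hQd.symm) hPm.ne_zero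
      (by rw [hPm.leadingCoeff, hQm.leadingCoeff])
  have h := Lagrange.coeff_eq_sum hv hdeg
  rw [coeff_sub, hP, hQ, prod_X_sub_C_coeff_card_pred S _ hne.card_pos,
    prod_X_sub_C_coeff_card_pred S _ hne.card_pos, Finset.sum_add_distrib] at h
  have h' : ∑ s ∈ S, w s * ∏ t ∈ S.erase s, (1 - w t / (v s - v t)) =
      -∑ i ∈ S, eval (v i) (∏ t ∈ S, (X - C (v t + w t)) - ∏ t ∈ S, (X - C (v t))) /
        ∏ j ∈ S.erase i, (v i - v j) := by
    rw [← Finset.sum_neg_distrib]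
    refine Finset.sum_congr rfl fun s hs => ?_
    rw [eval_sub, eval_prod, eval_prod, ← Finset.mul_prod_erase S _ hs,
      ← Finset.mul_prod_erase S (fun t => eval (v s) (X - C (v t))) hs]
    simp only [eval_sub, eval_X, eval_C, sub_self, zero_mul, sub_zero]
    rw [mul_div_assoc, ← Finset.prod_div_distrib, ← neg_mul]
    congr 1
    · ring
    · refine Finset.prod_congr rfl fun t ht => ?_
      have : v s - v t ≠ 0 := sub_ne_zero.2 fun h =>
        (Finset.ne_of_mem_erase ht) (hv hs (Finset.mem_of_mem_erase ht) h).symm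
      field_simp
      ring
  rw [h', ← h]
  ring

theorem sum_mul_prod_shift {S : Finset ℕ} (h0 : 0 ∉ S) :
    ∑ s ∈ S, (s : ℚ) * ∏ t ∈ S.erase s,
      (((s : ℚ) - 1 - t) * (s + t)) / ((s - t) * (s - 1 + t)) = ∑ s ∈ S, (s : ℚ) := by
  have hpos : ∀ s ∈ S, (1 : ℚ) ≤ s := fun s hs => by
    have : s ≠ 0 := by rintro rfl; exact h0 hs
    exact_mod_cast Nat.one_le_iff_ne_zero.2 this
  have hne : ∀ s ∈ S, ∀ t ∈ S, s ≠ t → (s : ℚ) - t ≠ 0 ∧ (s : ℚ) - 1 + t ≠ 0 := by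
    intro s hs t ht hst
    refine ⟨sub_ne_zero.2 (by exact_mod_cast hst), ?_⟩
    have := hpos s hs
    have := hpos t ht
    linarith
  -- With `v s = s (s - 1)` and `w s = 2 s`, both `v s - v t` and `v s - v t - w t` factor: they are
  -- `(s - t)(s - 1 + t)` and `(s - 1 - t)(s + t)`.
  have h := sum_mul_prod_one_sub_div S (fun s : ℕ => (s : ℚ) * (s - 1)) (fun s : ℕ => 2 * (s : ℚ))
    (by
      intro s hs t ht hst
      by_contra hst'
      obtain ⟨h1, h2⟩ := hne s hs t ht hst'
      simp only at hst
      have : ((s : ℚ) - t) * (s - 1 + t) = 0 := by linarith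
      rcases mul_eq_zero.1 this with h | h
      · exact h1 h
      · exact h2 h)
  simp only [mul_assoc, ← Finset.mul_sum] at h
  rw [← mul_left_cancel₀ two_ne_zero h]
  refine Finset.sum_congr rfl fun s hs => ?_
  congr 1
  refine Finset.prod_congr rfl fun t ht => ?_
  obtain ⟨h1, h2⟩ := hne s hs t (Finset.mem_of_mem_erase ht) (Finset.ne_of_mem_erase ht).symm
  rw [show (s : ℚ) * (s - 1) - t * (t - 1) = (s - t) * (s - 1 + t) by ring]
  field_simp
  ring

/-- `∏ 1 / s! ∏_{t < s} (s - t) / (s + t)`. -/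
noncomputable def shiftedWeight (S : Finset ℕ) : ℚ :=
  ∏ s ∈ S, ((s ! : ℚ)⁻¹ * ∏ t ∈ S, if t < s then ((s : ℚ) - t) / (s + t) else 1)

theorem shiftedWeight_insert {a : ℕ} {S : Finset ℕ} (ha : a ∉ S) :
    shiftedWeight (insert a S) =
      shiftedWeight S * ((a ! : ℚ)⁻¹ * ∏ t ∈ S, |(a : ℚ) - t| / (a + t)) := by
  have h : ∀ t ∈ S, |(a : ℚ) - t| / (a + t) = (if t < a then ((a : ℚ) - t) / (a + t) else 1) *
      if a < t then ((t : ℚ) - a) / (t + a) else 1 := by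
    intro t ht
    rcases lt_trichotomy a t with h | h | h
    · have : (a : ℚ) < t := by exact_mod_cast h
      rw [if_neg h.not_gt, if_pos h, abs_of_neg (by linarith), add_comm]
      ring
    · subst h
      exact absurd ht ha
    · have : (t : ℚ) < a := by exact_mod_cast h
      rw [if_neg h.not_gt, if_pos h, abs_of_pos (by linarith), mul_one]
  rw [Finset.prod_congr rfl h, Finset.prod_mul_distrib, shiftedWeight, Finset.prod_insert ha,
    Finset.prod_insert ha, if_neg (lt_irrefl a), one_mul]
  simp only [Finset.prod_insert ha]
  simp only [Finset.prod_mul_distrib, shiftedWeight]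
  ring

theorem shiftedWeight_erase_zero (S : Finset ℕ) :
    shiftedWeight (S.erase 0) = shiftedWeight S := by
  by_cases h0 : 0 ∈ S
  · conv_rhs => rw [← Finset.insert_erase h0]
    rw [shiftedWeight_insert (by simp), Finset.prod_eq_one]
    · simp
    · intro t ht
      have : (t : ℚ) ≠ 0 := by exact_mod_cast Finset.ne_of_mem_erase ht
      simp [this]
  · rw [Finset.erase_eq_of_notMem h0]

theorem shiftedWeight_moveDown {s : ℕ} {S : Finset ℕ} (h0 : 0 ∉ S) (hs : s ∈ S)
    (hs' : s - 1 ∉ S) :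
    shiftedWeight (moveDown s S) = shiftedWeight S * (s * ∏ t ∈ S.erase s,
      (((s : ℚ) - 1 - t) * (s + t)) / ((s - t) * (s - 1 + t))) := by
  obtain ⟨d, rfl⟩ : ∃ d, s = d + 1 :=
    Nat.exists_eq_succ_of_ne_zero (by rintro rfl; exact h0 hs)
  rw [Nat.add_sub_cancel] at hs'
  conv_rhs => rw [← Finset.insert_erase hs]
  rw [moveDown, shiftedWeight_erase_zero, Nat.add_sub_cancel, shiftedWeight_insert (by simp [hs']),
    shiftedWeight_insert (by simp), Finset.erase_insert (by simp), mul_assoc]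
  congr 1
  rw [Nat.factorial_succ, mul_mul_mul_comm, ← Finset.prod_mul_distrib]
  congr 1
  · have : ((d ! : ℕ) : ℚ) ≠ 0 := by exact_mod_cast Nat.factorial_ne_zero d
    push_cast
    field_simp
  · refine Finset.prod_congr rfl fun t ht => ?_
    have htS := Finset.mem_of_mem_erase ht
    have ht0 : t ≠ 0 := by rintro rfl; exact h0 htS
    have htd : t ≠ d := by rintro rfl; exact hs' htS
    have htd' := Finset.ne_of_mem_erase ht
    have hd : (0 : ℚ) ≤ d := Nat.cast_nonneg d
    have htpos : (0 : ℚ) < t := by exact_mod_cast Nat.pos_of_ne_zero ht0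
    push_cast
    rcases lt_or_gt_of_ne htd with h | h
    · have : (t : ℚ) < d := by exact_mod_cast h
      rw [abs_of_pos (by linarith), abs_of_pos (by linarith)]
      have h1 : (d : ℚ) + 1 - t ≠ 0 := by linarith
      have h2 : (d : ℚ) + t ≠ 0 := by linarith
      have h3 : (d : ℚ) + 1 - 1 + t ≠ 0 := by linarith
      have h4 : (d : ℚ) + 1 + t ≠ 0 := by linarith
      field_simp
      ring
    · have : (d : ℚ) + 1 < t := by exact_mod_cast (by omega : d + 1 < t)
      rw [abs_of_neg (by linarith), abs_of_neg (by linarith)]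
      have h1 : (d : ℚ) + 1 - t ≠ 0 := by linarith
      have h2 : (d : ℚ) + t ≠ 0 := by linarith
      have h3 : (d : ℚ) + 1 - 1 + t ≠ 0 := by linarith
      have h4 : (d : ℚ) + 1 + t ≠ 0 := by linarith
      field_simp
      ring

/-- The number of standard tableaux of a shifted shape. -/
theorem shiftedCount_eq_factorial_mul : ∀ (N : ℕ) (S : Finset ℕ), ∑ t ∈ S, t = N → 0 ∉ S →
    shiftedCount S = (N ! : ℚ) * shiftedWeight S := by
  intro N
  induction N with
  | zero =>
    intro S hN h0
    have : S = ∅ := Finset.eq_empty_of_forall_notMem fun t ht => h0 (by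
      rwa [Finset.sum_eq_zero_iff.1 hN t ht] at ht)
    rw [this, shiftedCount_empty]
    simp [shiftedWeight]
  | succ N ih =>
    intro S hN h0
    have hne : S.Nonempty := by
      rw [Finset.nonempty_iff_ne_empty]
      rintro rfl
      simp at hN
    rw [shiftedCount_eq_downSum h0 hne, downSum]
    have hterm : ∀ s ∈ S, (if s - 1 ∈ S then 0 else shiftedCount (moveDown s S)) =
        (N ! : ℚ) * shiftedWeight S * (s * ∏ t ∈ S.erase s,
          (((s : ℚ) - 1 - t) * (s + t)) / ((s - t) * (s - 1 + t))) := by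
      intro s hs
      split_ifs with hs'
      · have hs0 : s ≠ 0 := by rintro rfl; exact h0 hs
        -- The factor at `t = s - 1` vanishes, so blocked moves fit the same formula and the sum may
        -- run over all parts.
        rw [Finset.prod_eq_zero (i := s - 1) (Finset.mem_erase.2 ⟨by omega, hs'⟩)]
        · simp
        · rw [Nat.cast_sub (by omega)]
          simp
      · have := sum_id_moveDown h0 hs hs'
        rw [ih _ (by omega) (zero_notMem_moveDown _ _), shiftedWeight_moveDown h0 hs hs', mul_assoc]
    rw [Finset.sum_congr rfl hterm, ← Finset.mul_sum, sum_mul_prod_shift h0, ← Nat.cast_sum, hN,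
      Nat.factorial_succ]
    push_cast
    ring

/-! ### Evaluation at the staircase -/

theorem Icc_one_succ (n : ℕ) : Finset.Icc 1 (n + 1) = insert (n + 1) (Finset.Icc 1 n) := by
  ext
  simp
  omega

theorem prod_Icc_add (a n : ℕ) :
    ∏ t ∈ Finset.Icc 1 n, ((a : ℚ) + t) = ((a + n)! : ℚ) / (a ! : ℚ) := by
  have ha : ((a ! : ℕ) : ℚ) ≠ 0 := by exact_mod_cast Nat.factorial_ne_zero a
  induction n with
  | zero => simp [ha]
  | succ n ih =>
    rw [Icc_one_succ, Finset.prod_insert (by simp), ih, ← Nat.add_assoc, Nat.factorial_succ]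
    push_cast
    ring

theorem prod_Icc_sub (n c : ℕ) :
    ∏ t ∈ Finset.Icc 1 n, |((n + 1 + c : ℕ) : ℚ) - t| = ((n + c)! : ℚ) / (c ! : ℚ) := by
  induction n generalizing c with
  | zero =>
    have : ((c ! : ℕ) : ℚ) ≠ 0 := by exact_mod_cast Nat.factorial_ne_zero c
    simp [this]
  | succ n ih =>
    have hc : ((c ! : ℕ) : ℚ) ≠ 0 := by exact_mod_cast Nat.factorial_ne_zero c
    have hc' : (c : ℚ) + 1 ≠ 0 := by positivity
    rw [Icc_one_succ, Finset.prod_insert (by simp), show n + 1 + 1 + c = n + 1 + (c + 1) by ring,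
      ih (c + 1), show ((n + 1 + (c + 1) : ℕ) : ℚ) - ((n + 1 : ℕ) : ℚ) = c + 1 by push_cast; ring,
      abs_of_pos (by positivity), Nat.factorial_succ c, show n + 1 + c = n + (c + 1) by ring]
    push_cast
    field_simp

theorem shiftedWeight_insert_Icc (n c : ℕ) :
    shiftedWeight (insert (n + 1 + c) (Finset.Icc 1 n)) =
      shiftedWeight (Finset.Icc 1 n) * (((n + c)! : ℚ) / ((c ! : ℚ) * ((2 * n + 1 + c)! : ℚ))) := by
  rw [shiftedWeight_insert (by simp; omega), Finset.prod_div_distrib, prod_Icc_sub, prod_Icc_add,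
    show n + 1 + c + n = 2 * n + 1 + c by ring]
  have h1 : (((n + 1 + c)! : ℕ) : ℚ) ≠ 0 := by exact_mod_cast Nat.factorial_ne_zero _
  have h2 : (((2 * n + 1 + c)! : ℕ) : ℚ) ≠ 0 := by exact_mod_cast Nat.factorial_ne_zero _
  have h3 : ((c ! : ℕ) : ℚ) ≠ 0 := by exact_mod_cast Nat.factorial_ne_zero c
  field_simp

theorem prod_Icc_erase_abs_sub (i d : ℕ) :
    ∏ t ∈ (Finset.Icc 1 (i + 1 + d)).erase (i + 1), |((i + 1 : ℕ) : ℚ) - t| =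
      (i ! : ℚ) * (d ! : ℚ) := by
  induction d with
  | zero =>
    rw [Nat.add_zero, Icc_one_succ, Finset.erase_insert (by simp)]
    simpa using prod_Icc_sub i 0
  | succ d ih =>
    rw [← Nat.add_assoc, Icc_one_succ, Finset.erase_insert_of_ne (by omega),
      Finset.prod_insert (by simp), ih,
      show ((i + 1 : ℕ) : ℚ) - ((i + 1 + d + 1 : ℕ) : ℚ) = -(d + 1) by push_cast; ring,
      abs_neg, abs_of_pos (by positivity), Nat.factorial_succ]
    push_cast
    ring

theorem prod_Icc_erase_div (i d : ℕ) :
    ∏ t ∈ (Finset.Icc 1 (i + 1 + d)).erase (i + 1),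
        |((i + 1 : ℕ) : ℚ) - t| / (((i + 1 : ℕ) : ℚ) + t) =
      2 * ((i + 1)! : ℚ) ^ 2 * (d ! : ℚ) / ((i + 1 + (i + 1 + d))! : ℚ) := by
  have h := prod_Icc_add (i + 1) (i + 1 + d)
  rw [← Finset.mul_prod_erase _ _ (show i + 1 ∈ Finset.Icc 1 (i + 1 + d) by simp)] at h
  have hi : (i : ℚ) + 1 ≠ 0 := by positivity
  have h1 : (((i + 1)! : ℕ) : ℚ) ≠ 0 := by exact_mod_cast Nat.factorial_ne_zero _
  have h2 : (((i + 1 + (i + 1 + d))! : ℕ) : ℚ) ≠ 0 := by exact_mod_cast Nat.factorial_ne_zero _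
  have h' : ∏ t ∈ (Finset.Icc 1 (i + 1 + d)).erase (i + 1), (((i + 1 : ℕ) : ℚ) + t) =
      ((i + 1 + (i + 1 + d))! : ℚ) / (((i + 1)! : ℚ) * (2 * ((i : ℚ) + 1))) := by
    rw [eq_div_iff (by positivity)]
    rw [eq_div_iff h1] at h
    rw [← h]
    push_cast
    ring
  rw [Finset.prod_div_distrib, prod_Icc_erase_abs_sub, h']
  rw [Nat.factorial_succ i] at h1 ⊢
  push_cast at h1 ⊢
  field_simp

theorem shiftedWeight_insert_Icc_erase (i d : ℕ) :
    shiftedWeight (insert (2 * (i + 1 + d) + 2 + (i + 1)) ((Finset.Icc 1 (i + 1 + d)).erase (i + 1)))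
      = shiftedWeight (Finset.Icc 1 (i + 1 + d)) * (((2 * (i + 1 + d) + 1 + (i + 1))! : ℚ) /
        (2 * ((i + 1 + d : ℕ) + 1) * ((3 * (i + 1 + d) + 2 + (i + 1))! : ℚ) *
          ((i + 1)! : ℚ) * (d ! : ℚ))) := by
  obtain ⟨p, hp⟩ : ∃ p, i + 1 + d = p := ⟨_, rfl⟩
  have hmem : i + 1 ∈ Finset.Icc 1 p := Finset.mem_Icc.2 (by omega)
  have hprod := prod_Icc_erase_div i d
  have h1 := shiftedWeight_insert_Icc p (p + 1 + (i + 1))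
  rw [hp] at hprod ⊢
  -- The weight of `1, …, p` with the large part added is known. Viewing `i + 1` as the part
  -- inserted last, and dividing by its factor, yields the weight without it.
  rw [show p + 1 + (p + 1 + (i + 1)) = 2 * p + 2 + (i + 1) by ring,
    ← Finset.insert_erase hmem, Finset.insert_comm, Finset.insert_erase hmem,
    shiftedWeight_insert (by simp),
    Finset.prod_insert (by simp; omega), hprod,
    show p + (p + 1 + (i + 1)) = 2 * p + 1 + (i + 1) by ring,
    show 2 * p + 1 + (p + 1 + (i + 1)) = 3 * p + 2 + (i + 1) by ring,
    show p + 1 + (i + 1) = i + 1 + p + 1 by ring, Nat.factorial_succ (i + 1 + p)] at h1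
  have e : |((i + 1 : ℕ) : ℚ) - ((2 * p + 2 + (i + 1) : ℕ) : ℚ)| = 2 * ((p : ℚ) + 1) := by
    rw [show ((i + 1 : ℕ) : ℚ) - ((2 * p + 2 + (i + 1) : ℕ) : ℚ) = -(2 * ((p : ℚ) + 1)) by
      push_cast; ring, abs_neg, abs_of_pos (by positivity)]
  rw [e] at h1
  have f1 : (((i + 1)! : ℕ) : ℚ) ≠ 0 := by exact_mod_cast Nat.factorial_ne_zero _
  have f2 : ((d ! : ℕ) : ℚ) ≠ 0 := by exact_mod_cast Nat.factorial_ne_zero _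
  have f3 : (((i + 1 + p)! : ℕ) : ℚ) ≠ 0 := by exact_mod_cast Nat.factorial_ne_zero _
  have f4 : (((3 * p + 2 + (i + 1))! : ℕ) : ℚ) ≠ 0 := by exact_mod_cast Nat.factorial_ne_zero _
  generalize shiftedWeight (insert (2 * p + 2 + (i + 1)) ((Finset.Icc 1 p).erase (i + 1))) = x
    at h1 ⊢
  generalize (((i + 1)! : ℕ) : ℚ) = A at *
  generalize ((d ! : ℕ) : ℚ) = B at *
  push_cast at h1
  generalize (((i + 1 + p)! : ℕ) : ℚ) = C at *
  generalize (((3 * p + 2 + (i + 1))! : ℕ) : ℚ) = D at *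
  have g1 : (p : ℚ) + 1 ≠ 0 := by positivity
  have g2 : (i : ℚ) + 1 + p + 1 ≠ 0 := by positivity
  have g3 : (i : ℚ) + 1 + (2 * p + 2 + (i + 1)) ≠ 0 := by positivity
  field_simp at h1 ⊢
  apply mul_left_cancel₀ g2
  linear_combination (1 / 2) * h1

theorem passSign_Icc (b n : ℕ) : passSign b (Finset.Icc 1 n) = (-1) ^ (n - b) := by
  rw [passSign, Finset.prod_ite, Finset.prod_const, Finset.prod_const, one_pow, mul_one,
    show (Finset.Icc 1 n).filter (b < ·) = Finset.Ioc b n by ext; simp; omega, Nat.card_Ioc]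

theorem sum_alternating_choose_succ (p : ℕ) (f : ℕ → ℚ) :
    ∑ j ∈ Finset.range (p + 2), (-1) ^ j * ((p + 1).choose j : ℚ) * f j =
      ∑ j ∈ Finset.range (p + 1), (-1) ^ j * (p.choose j : ℚ) * f j -
        ∑ j ∈ Finset.range (p + 1), (-1) ^ j * (p.choose j : ℚ) * f (j + 1) := by
  have h : ∑ j ∈ Finset.range (p + 1), (-1) ^ j * (p.choose j : ℚ) * f j =
      ∑ j ∈ Finset.range (p + 2), (-1) ^ j * (p.choose j : ℚ) * f j := by
    rw [Finset.sum_range_succ _ (p + 1)]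
    simp
  rw [h, Finset.sum_range_succ', Finset.sum_range_succ' _ (p + 1), add_sub_right_comm,
    ← Finset.sum_sub_distrib]
  congr 1
  · refine Finset.sum_congr rfl fun j _ => ?_
    rw [Nat.choose_succ_succ]
    push_cast
    ring
  · simp

/-- Up to `b !`, the quotient is the Beta integral of `x ^ (a + j) * (1 - x) ^ b`; the alternating
sum inserts `(1 - x) ^ p`. The proof is the discrete version, Pascal's rule with `a` varying. -/
theorem sum_alternating_choose_mul_factorial_div (p a b : ℕ) :
    ∑ j ∈ Finset.range (p + 1),
        (-1) ^ j * (p.choose j : ℚ) * (((a + j)! : ℚ) / ((a + b + 1 + j)! : ℚ)) =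
      ((a ! : ℚ) * ((b + p)! : ℚ)) / ((b ! : ℚ) * ((a + b + p + 1)! : ℚ)) := by
  induction p generalizing a with
  | zero =>
    have : ((b ! : ℕ) : ℚ) ≠ 0 := by exact_mod_cast Nat.factorial_ne_zero b
    simp
    field_simp
  | succ p ih =>
    have h := ih (a + 1)
    rw [sum_alternating_choose_succ, ih a]
    have e : ∀ j, (((a + (j + 1))! : ℚ) / ((a + b + 1 + (j + 1))! : ℚ)) =
        (((a + 1 + j)! : ℚ) / ((a + 1 + b + 1 + j)! : ℚ)) := fun j => by
      rw [show a + (j + 1) = a + 1 + j by ring, show a + b + 1 + (j + 1) = a + 1 + b + 1 + j by ring]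
    simp only [e]
    rw [h, show a + 1 + b + p + 1 = a + b + p + 1 + 1 by ring,
      show a + b + (p + 1) + 1 = a + b + p + 1 + 1 by ring, Nat.factorial_succ (a + b + p + 1),
      Nat.factorial_succ a, show b + (p + 1) = b + p + 1 by ring, Nat.factorial_succ (b + p)]
    have h1 : ((b ! : ℕ) : ℚ) ≠ 0 := by exact_mod_cast Nat.factorial_ne_zero b
    have h2 : (((a + b + p + 1)! : ℕ) : ℚ) ≠ 0 := by exact_mod_cast Nat.factorial_ne_zero _
    push_cast
    have h3 : (a : ℚ) + b + p + 1 + 1 ≠ 0 := by positivity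
    field_simp
    ring

/-- For `j > 0` the annihilation factor `2` cancels the `2` in the denominator of the weight, so the
case `j = 0` obeys the same formula. The signs `(-1) ^ j` and `(-1) ^ (p - j)` combine to `(-1) ^
p`. -/
theorem fermion_shiftedCountInsert_Icc {p j : ℕ} (hj : j ≤ p) :
    fermion (-(j : ℤ)) (shiftedCountInsert (2 * p + 2 + j)) (Finset.Icc 1 p) =
      (-1) ^ p * ((((2 * p + 2 + ∑ t ∈ Finset.Icc 1 p, t)! : ℚ) * shiftedWeight (Finset.Icc 1 p)) *
        (((2 * p + 1 + j)! : ℚ) /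
          (((p : ℚ) + 1) * ((3 * p + 2 + j)! : ℚ) * (j ! : ℚ) * ((p - j)! : ℚ)))) := by
  have hp : ((p ! : ℕ) : ℚ) ≠ 0 := by exact_mod_cast Nat.factorial_ne_zero p
  rcases j with _ | i
  · have hw := shiftedWeight_insert_Icc p (p + 1)
    rw [show p + 1 + (p + 1) = 2 * p + 2 by ring, show p + (p + 1) = 2 * p + 1 by ring,
      show 2 * p + 1 + (p + 1) = 3 * p + 2 by ring, Nat.factorial_succ p] at hw
    rw [Nat.cast_zero, neg_zero, fermion_zero, passSign_Icc, shiftedCountInsert,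
      shiftedCount_eq_factorial_mul _ _ (Finset.sum_insert (by simp; omega)) (by simp), Nat.add_zero,
      hw]
    simp only [Nat.sub_zero, Nat.add_zero, Nat.factorial_zero]
    push_cast
    ring
  · obtain ⟨d, rfl⟩ := Nat.exists_eq_add_of_le hj
    have hmem : i + 1 ∈ Finset.Icc 1 (i + 1 + d) := Finset.mem_Icc.2 (by omega)
    have hsum : ∑ t ∈ insert (2 * (i + 1 + d) + 2 + (i + 1)) ((Finset.Icc 1 (i + 1 + d)).erase (i + 1)),
        t = 2 * (i + 1 + d) + 2 + ∑ t ∈ Finset.Icc 1 (i + 1 + d), t := by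
      rw [Finset.sum_insert (by simp; omega), ← Finset.add_sum_erase _ _ hmem]
      ring
    rw [show (-((i + 1 : ℕ) : ℤ)) = .negSucc i from rfl, fermion_negSucc, if_pos hmem, passSign_Icc,
      shiftedCountInsert, shiftedCount_eq_factorial_mul _ _ hsum (by simp),
      shiftedWeight_insert_Icc_erase, Nat.add_sub_cancel_left, pow_add (-1 : ℚ) (i + 1) d]
    have h1 : (((i + 1)! : ℕ) : ℚ) ≠ 0 := by exact_mod_cast Nat.factorial_ne_zero _
    have h2 : ((d ! : ℕ) : ℚ) ≠ 0 := by exact_mod_cast Nat.factorial_ne_zero _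
    have h3 : (((3 * (i + 1 + d) + 2 + (i + 1))! : ℕ) : ℚ) ≠ 0 := by
      exact_mod_cast Nat.factorial_ne_zero _
    have h4 : ((i + 1 + d : ℕ) : ℚ) + 1 ≠ 0 := by positivity
    field_simp

theorem alternatingCount_Icc (p : ℕ) :
    alternatingCount (p + 1) (Finset.Icc 1 p) =
      (((2 * p + 2 + ∑ t ∈ Finset.Icc 1 p, t)! : ℚ) * shiftedWeight (Finset.Icc 1 p)) *
        (((2 * p + 1)! : ℚ) * ((2 * p)! : ℚ) /
          (((p : ℚ) + 1) * (p ! : ℚ) ^ 2 * ((4 * p + 2)! : ℚ))) := by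
  have hp : ((p ! : ℕ) : ℚ) ≠ 0 := by exact_mod_cast Nat.factorial_ne_zero p
  rw [alternatingCount, show 2 * (p + 1) - 1 = p + (p + 1) by omega, Finset.sum_range_add,
    Finset.sum_eq_zero, zero_add]
  · have hterm : ∀ j ∈ Finset.range (p + 1), (-1) ^ (p + j) *
        fermion (((p + 1 : ℕ) : ℤ) - 1 - ((p + j : ℕ) : ℤ)) (shiftedCountInsert (p + 1 + 1 + (p + j)))
          (Finset.Icc 1 p) =
        (((2 * p + 2 + ∑ t ∈ Finset.Icc 1 p, t)! : ℚ) * shiftedWeight (Finset.Icc 1 p)) *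
          (((p : ℚ) + 1) * (p ! : ℚ))⁻¹ * ((-1) ^ j * (p.choose j : ℚ) *
            (((2 * p + 1 + j)! : ℚ) / ((2 * p + 1 + p + 1 + j)! : ℚ))) := by
      intro j hj
      have hj' : j ≤ p := Nat.lt_succ_iff.1 (Finset.mem_range.1 hj)
      rw [show ((p + 1 : ℕ) : ℤ) - 1 - ((p + j : ℕ) : ℤ) = -(j : ℤ) by push_cast; ring,
        show p + 1 + 1 + (p + j) = 2 * p + 2 + j by ring, fermion_shiftedCountInsert_Icc hj',
        show 2 * p + 1 + p + 1 + j = 3 * p + 2 + j by ring, Nat.cast_choose ℚ hj', pow_add]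
      have h1 : ((j ! : ℕ) : ℚ) ≠ 0 := by exact_mod_cast Nat.factorial_ne_zero _
      have h2 : (((p - j)! : ℕ) : ℚ) ≠ 0 := by exact_mod_cast Nat.factorial_ne_zero _
      have h3 : (((3 * p + 2 + j)! : ℕ) : ℚ) ≠ 0 := by exact_mod_cast Nat.factorial_ne_zero _
      have h4 : (p : ℚ) + 1 ≠ 0 := by positivity
      have h5 : ((-1 : ℚ) ^ p) * (-1) ^ p = 1 := by rw [← mul_pow]; simp
      field_simp
      linear_combination shiftedWeight (Finset.Icc 1 p) * h5
    rw [Finset.sum_congr rfl hterm, ← Finset.mul_sum, sum_alternating_choose_mul_factorial_div,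
      show p + p = 2 * p by ring, show 2 * p + 1 + p + p + 1 = 4 * p + 2 by ring, mul_assoc]
    congr 1
    have h3 : (((4 * p + 2)! : ℕ) : ℚ) ≠ 0 := by exact_mod_cast Nat.factorial_ne_zero _
    field_simp
  -- For `k < p` the operator would create a part `p - k`, already present in `1, …, p`.
  · intro k hk
    have hk' := Finset.mem_range.1 hk
    obtain ⟨b, hb⟩ : ∃ b, p = k + b + 1 := ⟨p - k - 1, by omega⟩
    rw [show ((p + 1 : ℕ) : ℤ) - 1 - (k : ℤ) = ((b + 1 : ℕ) : ℤ) by rw [hb]; push_cast; ring,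
      fermion_succ, if_pos (Finset.mem_Icc.2 (by omega)), mul_zero]

/-! ### Comparison with `staircaseNumber` and Catalan numbers -/

theorem shiftedWeight_Icc_succ (n : ℕ) :
    shiftedWeight (Finset.Icc 1 (n + 1)) =
      shiftedWeight (Finset.Icc 1 n) * ((n ! : ℚ) / ((2 * n + 1)! : ℚ)) := by
  simpa [Icc_one_succ n] using shiftedWeight_insert_Icc n 0

theorem shiftedWeight_Icc (n : ℕ) :
    shiftedWeight (Finset.Icc 1 n) =
      (∏ j ∈ Finset.range (n + 1), ∏ i ∈ Finset.range j, ((i : ℚ) + (j : ℚ)))⁻¹ := by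
  induction n with
  | zero => simp [shiftedWeight]
  | succ n ih =>
    have h : ∀ c : ℕ, ∏ i ∈ Finset.range c, ((i : ℚ) + ((n + 1 : ℕ) : ℚ)) =
        ((n + c)! : ℚ) / (n ! : ℚ) := by
      intro c
      have hn : ((n ! : ℕ) : ℚ) ≠ 0 := by exact_mod_cast Nat.factorial_ne_zero n
      induction c with
      | zero => simp [hn]
      | succ c ihc =>
        rw [Finset.prod_range_succ, ihc, ← Nat.add_assoc, Nat.factorial_succ]
        push_cast
        ring
    rw [Finset.prod_range_succ, mul_inv, ← ih, h, inv_div, shiftedWeight_Icc_succ,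
      show n + (n + 1) = 2 * n + 1 by ring]

theorem sum_Icc_id (n : ℕ) : ∑ t ∈ Finset.Icc 1 n, t = (n + 1).choose 2 := by
  induction n with
  | zero => rfl
  | succ n ih =>
    rw [Icc_one_succ, Finset.sum_insert (by simp), ih, Nat.choose_succ_succ (n + 1) 1,
      Nat.choose_one_right]

theorem staircaseNumber_eq (n : ℕ) :
    staircaseNumber n = (((n + 1).choose 2)! : ℚ) * shiftedWeight (Finset.Icc 1 n) := by
  rw [staircaseNumber, shiftedWeight_Icc, div_eq_mul_inv]

theorem cast_catalan (n : ℕ) :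
    (catalan n : ℚ) = ((2 * n)! : ℚ) / ((n ! : ℚ) * ((n + 1)! : ℚ)) := by
  have h : (((n + 1) * catalan n : ℕ) : ℚ) = ((Nat.centralBinom n : ℕ) : ℚ) := by
    rw [succ_mul_catalan_eq_centralBinom]
  rw [Nat.centralBinom_eq_two_mul_choose, Nat.cast_choose ℚ (by omega),
    show 2 * n - n = n by omega] at h
  rw [Nat.factorial_succ]
  have h1 : ((n ! : ℕ) : ℚ) ≠ 0 := by exact_mod_cast Nat.factorial_ne_zero n
  have h2 : (n : ℚ) + 1 ≠ 0 := by positivity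
  push_cast at h ⊢
  field_simp at h ⊢
  linarith

theorem alternatingCount_Icc_eq_staircaseNumber_mul (p : ℕ) :
    alternatingCount (p + 1) (Finset.Icc 1 p) = staircaseNumber (p + 2) *
      (((catalan (p + 2) : ℚ) * (catalan p : ℚ)) / (2 * (catalan (2 * p + 1) : ℚ))) := by
  -- The truncated shape has one box fewer than the full staircase, so the factorials differ by the
  -- factor `(p + 2) (p + 3) / 2`.
  have hN : 2 * p + 2 + ∑ t ∈ Finset.Icc 1 p, t + 1 = (p + 2 + 1).choose 2 := by
    rw [← sum_Icc_id (p + 2), Icc_one_succ (p + 1), Icc_one_succ p, Finset.sum_insert (by simp),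
      Finset.sum_insert (by simp)]
    ring
  have hN' : ((2 * p + 2 + ∑ t ∈ Finset.Icc 1 p, t : ℕ) : ℚ) + 1 = (p + 2) * (p + 3) / 2 := by
    have h : ((p + 2 + 1).choose 2 : ℚ) = (p + 2) * (p + 3) / 2 := by
      rw [Nat.cast_choose_two]
      push_cast
      ring
    rw [← h, ← hN]
    push_cast
    ring
  rw [alternatingCount_Icc, staircaseNumber_eq, ← hN,
    Nat.factorial_succ (2 * p + 2 + ∑ t ∈ Finset.Icc 1 p, t), Nat.cast_mul,
    Nat.cast_succ, hN', shiftedWeight_Icc_succ, shiftedWeight_Icc_succ, cast_catalan, cast_catalan,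
    cast_catalan, show 2 * (p + 1) + 1 = 2 * p + 1 + 1 + 1 by ring,
    show 2 * (p + 2) = 2 * p + 1 + 1 + 1 + 1 by ring, show 2 * (2 * p + 1) = 4 * p + 2 by ring]
  simp only [Nat.factorial_succ]
  have h1 : ((p ! : ℕ) : ℚ) ≠ 0 := by exact_mod_cast Nat.factorial_ne_zero p
  have h2 : (((2 * p)! : ℕ) : ℚ) ≠ 0 := by exact_mod_cast Nat.factorial_ne_zero _
  have h3 : (((4 * p + 2)! : ℕ) : ℚ) ≠ 0 := by exact_mod_cast Nat.factorial_ne_zero _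
  push_cast
  generalize ((p ! : ℕ) : ℚ) = A at *
  generalize (((2 * p)! : ℕ) : ℚ) = B at *
  generalize (((4 * p + 2)! : ℕ) : ℚ) = D at *
  field_simp
  ring

theorem theorem1 (n : ℕ) :
    (numStandardTableaux (shiftedTruncatedDiagram (staircase n) (staircase 0)) : ℚ) =
      staircaseNumber n ∧
    (3 ≤ n →
      (numStandardTableaux (shiftedTruncatedDiagram (staircase n) (staircase 1)) : ℚ) =
        staircaseNumber n *
          (((catalan n : ℚ) * (catalan (n - 2) : ℚ)) / (2 * (catalan (2 * n - 3) : ℚ)))) := by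
  constructor
  · rw [shiftedTruncatedDiagram_zero, staircaseNumber_eq]
    exact shiftedCount_eq_factorial_mul _ _ (sum_Icc_id n) (by simp)
  · intro hn
    obtain ⟨p, rfl⟩ : ∃ p, n = p + 1 + 1 := ⟨n - 2, by omega⟩
    rw [shiftedTruncatedDiagram_one (p + 1) (by omega), Nat.add_sub_cancel,
      show p + 1 + 1 - 2 = p by omega, show 2 * (p + 1 + 1) - 3 = 2 * p + 1 by omega,
      ← alternatingCount_Icc_eq_staircaseNumber_mul]
    refine truncatedCount_eq_alternatingCount (by omega) _ _ rfl (by simp) fun s hs => ?_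
    have := (Finset.mem_Icc.1 hs).2
    omega
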